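/- Let $I=[0,1]$ and let $G=(I,\mu,E)$ be a graphing: $E\subseteq I^2$ is a symmetric Borel set for which the degrees $|\{y\in I:(x,y)\in E\}|$, $x\in I$, are bounded by a common finite integer, and $\mu$ is a Borel probability measure on $I$ such that $\int_A\deg_B\,d\mu=\int_B\deg_A\,d\mu$ for all Borel sets $A,B\subseteq I$, where $\deg_B(x)=|\{y\in B:(x,y)\in E\}|$. Write $e_G(A,B)=\int_A\deg_B(x)\,d\mu(x)$, and let $\eta$ be the edge measure of $G$, that is, the unique Borel measure on $I^2$ with $\eta(A\times B)=e_G(A,B)$ for all Borel sets $A,B\subseteq I$. **Theorem (co-area formula for graphings).** Let $f:I\to\mathbb R$ be a function in $L^2(I,\mu)$. Put $f_+=\max\{f,0\}$, $f_-=-\min\{f,0\}$, $S_t=f^{-1}(t,\infty)$ for $t\in\mathbb R$, $E_f=\{(x,y)\in E: f(y)>f(x)\}$, and $dg(x,y)=g(y)-g(x)$ for $g:I\to\mathbb R$; below, $df_\pm^2$ means $d(f_\pm^2)$. Then $$\int_{E_f}|df_+^2|\,d\eta=\int_0^\infty e_G(S_{\sqrt t}^c,S_{\sqrt t})\,dt=\int_0^\infty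 2t\,e_G(S_t^c,S_t)\,dt$$ and $$\int_{E_f}|df_-^2|\,d\eta=\int_0^\infty e_G(S_{-\sqrt t}^c,S_{-\sqrt t})\,dt=\int_0^\infty 2t\,e_G(S_{-t}^c,S_{-t})\,dt,$$ where all the integrands are integrable, so that all six integrals are finite. -/

import Mathlib

open MeasureTheory Set
open scoped unitInterval ENNReal

noncomputable section

/-- The neighbours of `x` that lie in `B`, for the graph on `[0,1]` with edge set `E`. -/
def nbrsIn (E : Set (I × I)) (B : Set I) (x : I) : Set I := {y | y ∈ B ∧ (x, y) ∈ E}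

/-- `degIn E B x` is `deg_B(x)`, the number of neighbours of `x` in `B`. -/
def degIn (E : Set (I × I)) (B : Set I) (x : I) : ℝ := ((nbrsIn E B x).ncard : ℝ)

/-- A graphing `(I, μ, E)` on the unit interval. -/
structure Graphing where
  /-- the vertex measure -/
  μ : Measure I
  /-- the edge set -/
  E : Set (I × I)
  isProbabilityMeasure : IsProbabilityMeasure μ
  measurableSet_E : MeasurableSet E
  symm_E : ∀ x y : I, (x, y) ∈ E → (y, x) ∈ E
  bounded_degree : ∃ D : ℕ, 0 < D ∧ ∀ x : I, {y : I | (x, y) ∈ E}.encard ≤ (D : ℕ∞)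
  balanced : ∀ A B : Set I, MeasurableSet A → MeasurableSet B →
    ∫ x in A, degIn E B x ∂μ = ∫ x in B, degIn E A x ∂μ

namespace Graphing

attribute [instance] Graphing.isProbabilityMeasure

/-- The counting measure on the edges of `G` that leave the vertex `x`. -/
def edgeFiber (G : Graphing) (x : I) : Measure (I × I) :=
  (Measure.count.restrict {y : I | (x, y) ∈ G.E}).map (fun y => (x, y))

/-- The edge measure `η` on `I × I`, `η(S) = ∫ #{y | (x, y) ∈ E ∩ S} dμ(x)`. By
`Graphing.edgeMeasure_prod` and `Graphing.eq_edgeMeasure` below, it is the unique measure with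
`η(A × B) = ∫_A deg_B dμ` for all measurable `A` and `B`. -/
def edgeMeasure (G : Graphing) : Measure (I × I) := G.μ.bind G.edgeFiber

/-- `e_G(A, B) = ∫_A deg_B dμ`. -/
def e (G : Graphing) (A B : Set I) : ℝ := ∫ x in A, degIn G.E B x ∂G.μ

/-- The `f`-oriented edges `E_f`. -/
def orientedEdges (G : Graphing) (f : I → ℝ) : Set (I × I) :=
  {p | p ∈ G.E ∧ f p.1 < f p.2}

end Graphing

/-- The differential `(dg)(x, y) = g(y) - g(x)`. -/
def edgeDiff (g : I → ℝ) (p : I × I) : ℝ := g p.2 - g p.1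

/-- The superlevel set `S_t = f⁻¹(t, ∞)`. -/
def superlevel (f : I → ℝ) (t : ℝ) : Set I := f ⁻¹' Ioi t

/-- `f_+ = max {f, 0}`. -/
def plusPart (f : I → ℝ) (x : I) : ℝ := max (f x) 0

/-- `f_- = - min {f, 0}`. -/
def minusPart (f : I → ℝ) (x : I) : ℝ := -min (f x) 0

/-! Well-posedness of the edge measure. -/

theorem measurableSet_full_fiber (F : Set (I × I)) (hF : MeasurableSet F) (n : ℕ)
    (hn : ∀ x, {y : I | (x, y) ∈ F}.encard ≤ (n : ℕ∞)) :
    MeasurableSet {x | {y : I | (x, y) ∈ F}.encard = (n : ℕ∞)} := by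
  set T : Set (I × (Fin n → I)) :=
    {p | (∀ i j, i < j → p.2 i < p.2 j) ∧ ∀ i, (p.1, p.2 i) ∈ F} with hT
  have hTm : MeasurableSet T := by
    have h1 : T = (⋂ i, ⋂ j, ⋂ _ : i < j, {p : I × (Fin n → I) | p.2 i < p.2 j}) ∩
        ⋂ i, (fun p : I × (Fin n → I) => (p.1, p.2 i)) ⁻¹' F := by
      ext p; simp [hT]
    rw [h1]
    refine MeasurableSet.inter ?_ ?_
    · refine MeasurableSet.iInter fun i => MeasurableSet.iInter fun j =>
        MeasurableSet.iInter fun _ => measurableSet_lt (by fun_prop) (by fun_prop)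
    · exact MeasurableSet.iInter fun i => (by fun_prop : Measurable _) hF
  have hfin : ∀ x, {y : I | (x, y) ∈ F}.Finite := fun x =>
    Set.finite_of_encard_le_coe (hn x)
  have hrange : ∀ p ∈ T, Set.range p.2 = {y : I | (p.1, y) ∈ F} := by
    intro p hp
    have hmono : StrictMono p.2 := fun i j h => hp.1 i j h
    refine (Set.finite_range p.2).eq_of_subset_of_encard_le ?_ ?_
    · rintro _ ⟨i, rfl⟩; exact hp.2 i
    · refine (hn p.1).trans ?_
      rw [← Set.image_univ, hmono.injective.encard_image]
      simp
  have hinj : Set.InjOn Prod.fst T := by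
    rintro ⟨x, u⟩ hp ⟨x', v⟩ hq h
    obtain rfl : x = x' := h
    have hr := (hrange _ hp).trans (hrange _ hq).symm
    have : u = v := (StrictMono.range_inj (fun i j h => hp.1 i j h) (fun i j h => hq.1 i j h)).1 hr
    rw [this]
  have himg : {x | {y : I | (x, y) ∈ F}.encard = (n : ℕ∞)} = Prod.fst '' T := by
    ext x
    constructor
    · intro hx
      have hx' : {y : I | (x, y) ∈ F}.encard = (n : ℕ∞) := hx
      have hcard : (hfin x).toFinset.card = n := by
        rw [(hfin x).encard_eq_coe_toFinset_card] at hx'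
        exact_mod_cast hx'
      refine ⟨(x, (hfin x).toFinset.orderEmbOfFin hcard), ⟨?_, ?_⟩, rfl⟩
      · intro i j h
        exact ((hfin x).toFinset.orderEmbOfFin hcard).strictMono h
      · intro i
        exact (hfin x).mem_toFinset.mp ((hfin x).toFinset.orderEmbOfFin_mem hcard i)
    · rintro ⟨p, hp, rfl⟩
      have hmono : StrictMono p.2 := fun i j h => hp.1 i j h
      change {y : I | (p.1, y) ∈ F}.encard = _
      rw [← hrange p hp, ← Set.image_univ, hmono.injective.encard_image]
      simp
  rw [himg]
  exact hTm.image_of_measurable_injOn measurable_fst hinj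

/-- Counting the points of the vertical sections of a Borel set with sections of bounded size is
a measurable operation. -/
theorem measurable_encard_fiber (n : ℕ) : ∀ (F : Set (I × I)), MeasurableSet F →
    (∀ x, {y : I | (x, y) ∈ F}.encard ≤ (n : ℕ∞)) →
    Measurable fun x => ({y : I | (x, y) ∈ F}.encard : ℝ≥0∞) := by
  classical
  induction n with
  | zero =>
    intro F _ hn
    have : (fun x => ({y : I | (x, y) ∈ F}.encard : ℝ≥0∞)) = fun _ => 0 := by
      funext x
      have : {y : I | (x, y) ∈ F}.encard = 0 := by simpa using hn x
      rw [this]; simp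
    rw [this]; exact measurable_const
  | succ n ih =>
    intro F hF hn
    set T := {x | {y : I | (x, y) ∈ F}.encard = ((n + 1 : ℕ) : ℕ∞)} with hT
    have hTm : MeasurableSet T := measurableSet_full_fiber F hF (n + 1) hn
    have hF' : MeasurableSet (F ∩ Prod.fst ⁻¹' Tᶜ) := hF.inter (measurable_fst hTm.compl)
    have h := ih _ hF' (by
      intro x
      by_cases hx : x ∈ T
      · simp [hx]
      · have hlt : {y : I | (x, y) ∈ F}.encard < ((n + 1 : ℕ) : ℕ∞) := lt_of_le_of_ne (hn x) hx
        have h2 : {y : I | (x, y) ∈ F ∩ Prod.fst ⁻¹' Tᶜ} = {y : I | (x, y) ∈ F} := by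
          ext y; simp [hx]
        rw [h2]
        exact Order.le_of_lt_add_one (by simpa using hlt))
    have heq : (fun x => ({y : I | (x, y) ∈ F}.encard : ℝ≥0∞)) =
        T.piecewise (fun _ => ((n + 1 : ℕ) : ℝ≥0∞))
          (fun x => ({y : I | (x, y) ∈ F ∩ Prod.fst ⁻¹' Tᶜ}.encard : ℝ≥0∞)) := by
      funext x
      by_cases hx : x ∈ T
      · rw [Set.piecewise_eq_of_mem _ _ _ hx]
        have : {y : I | (x, y) ∈ F}.encard = ((n + 1 : ℕ) : ℕ∞) := hx
        rw [this]; simp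
      · rw [Set.piecewise_eq_of_notMem _ _ _ hx]
        have h2 : {y : I | (x, y) ∈ F ∩ Prod.fst ⁻¹' Tᶜ} = {y : I | (x, y) ∈ F} := by
          ext y; simp [hx]
        rw [h2]
    rw [heq]
    exact Measurable.piecewise hTm measurable_const h

namespace Graphing

theorem edgeFiber_apply (G : Graphing) (x : I) {S : Set (I × I)} (hS : MeasurableSet S) :
    G.edgeFiber x S = ({y : I | (x, y) ∈ G.E ∩ S}.encard : ℝ≥0∞) := by
  have hm : Measurable (fun y : I => (x, y)) := by fun_prop
  rw [edgeFiber, Measure.map_apply hm hS, Measure.restrict_apply (hm hS),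
    Measure.count_apply ((hm hS).inter (s₂ := {y : I | (x, y) ∈ G.E}) (hm G.measurableSet_E))]
  congr 2
  ext y
  simp [and_comm]

theorem measurable_edgeFiber (G : Graphing) : Measurable G.edgeFiber := by
  refine Measure.measurable_of_measurable_coe _ fun S hS => ?_
  simp only [G.edgeFiber_apply _ hS]
  obtain ⟨D, -, hD⟩ := G.bounded_degree
  refine measurable_encard_fiber D _ (G.measurableSet_E.inter hS) fun x => ?_
  exact (Set.encard_le_encard (fun y hy => hy.1)).trans (hD x)

theorem ofReal_degIn (G : Graphing) (B : Set I) (x : I) :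
    ENNReal.ofReal (degIn G.E B x) = ((nbrsIn G.E B x).encard : ℝ≥0∞) := by
  obtain ⟨D, -, hD⟩ := G.bounded_degree
  have hfin : (nbrsIn G.E B x).Finite := Set.finite_of_encard_le_coe
    ((Set.encard_le_encard (fun y hy => hy.2)).trans (hD x))
  rw [degIn, ← hfin.cast_ncard_eq]
  simp

theorem integrable_degIn (G : Graphing) {B : Set I} (hB : MeasurableSet B) :
    Integrable (degIn G.E B) G.μ := by
  obtain ⟨D, -, hD⟩ := G.bounded_degree
  have hle : ∀ x, (nbrsIn G.E B x).encard ≤ (D : ℕ∞) := fun x =>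
    (Set.encard_le_encard (fun y hy => hy.2)).trans (hD x)
  have hmeas : Measurable (degIn G.E B) := by
    have h := measurable_encard_fiber D (G.E ∩ Prod.snd ⁻¹' B)
      (G.measurableSet_E.inter (measurable_snd hB)) (fun x =>
        (Set.encard_le_encard (fun y hy => hy.1)).trans (hD x))
    have h2 : degIn G.E B =
        fun x => ({y : I | (x, y) ∈ G.E ∩ Prod.snd ⁻¹' B}.encard : ℝ≥0∞).toReal := by
      funext x
      have h3 : {y : I | (x, y) ∈ G.E ∩ Prod.snd ⁻¹' B} = nbrsIn G.E B x := by
        ext y; simp [nbrsIn, and_comm]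
      rw [h3, ← G.ofReal_degIn B x, ENNReal.toReal_ofReal (by exact Nat.cast_nonneg _)]
    rw [h2]
    exact h.ennreal_toReal
  refine Integrable.of_bound hmeas.aestronglyMeasurable (D : ℝ) (ae_of_all _ fun x => ?_)
  have h1 : (nbrsIn G.E B x).ncard ≤ D := by
    have hfin : (nbrsIn G.E B x).Finite := Set.finite_of_encard_le_coe (hle x)
    have := hle x
    rw [← hfin.cast_ncard_eq] at this
    exact_mod_cast this
  rw [degIn, Real.norm_of_nonneg (Nat.cast_nonneg _)]
  exact_mod_cast h1

/-- The edge measure has the prescribed values on measurable rectangles. -/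
theorem edgeMeasure_prod (G : Graphing) {A B : Set I} (hA : MeasurableSet A)
    (hB : MeasurableSet B) : G.edgeMeasure (A ×ˢ B) = ENNReal.ofReal (G.e A B) := by
  rw [edgeMeasure, Measure.bind_apply (hA.prod hB) G.measurable_edgeFiber.aemeasurable, e,
    ofReal_integral_eq_lintegral_ofReal (G.integrable_degIn hB).integrableOn
      (ae_of_all _ fun x => Nat.cast_nonneg _), ← lintegral_indicator hA]
  refine lintegral_congr fun x => ?_
  rw [G.edgeFiber_apply x (hA.prod hB)]
  by_cases hx : x ∈ A
  · rw [Set.indicator_of_mem hx, G.ofReal_degIn]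
    congr 2
    ext y
    simp [nbrsIn, hx, and_comm]
  · simp [hx]

/-- The edge measure is the only measure with these values. -/
theorem eq_edgeMeasure (G : Graphing) (ν : Measure (I × I))
    (hν : ∀ A B : Set I, MeasurableSet A → MeasurableSet B →
      ν (A ×ˢ B) = ENNReal.ofReal (G.e A B)) : ν = G.edgeMeasure := by
  have : IsFiniteMeasure ν := ⟨by
    rw [← Set.univ_prod_univ, hν _ _ MeasurableSet.univ MeasurableSet.univ]
    exact ENNReal.ofReal_lt_top⟩
  refine Measure.ext_prod fun {A B} hA hB => ?_
  rw [hν A B hA hB, G.edgeMeasure_prod hA hB]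

end Graphing

end

namespace Graphing

variable (G : Graphing)

/-! Both formulas are Tonelli's theorem for pairs (edge, level). At level `s t`, the value `e_G(Sᶜ,
S)` is the `η`-mass of the pairs with `f x ≤ s t < f y`. For a fixed pair with `f x < f y`, the set
of `t > 0` satisfying this has length `|w (f y) - w (f x)|`: take `s t = √t`, `w ∘ f = f_+²` or `s t
= -√t`, `w ∘ f = f_-²`. This gives `setLIntegral_abs_edgeDiff`, in `[0, ∞]` and for Borel `f`.
`coarea` extends it to `L²`. Bounded degree and balance make both marginals of `η` at most `D • μ`,
so `f²` stays integrable on the edges and all integrals are finite. Null sets of vertices affect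
neither `η` nor `e_G`, so `f` may be replaced by a Borel representative. The last equality is the
substitution `t ↦ t²`. -/

theorem e_nonneg (A B : Set I) : 0 ≤ G.e A B :=
  integral_nonneg fun _ => Nat.cast_nonneg _

instance isFiniteMeasure_edgeMeasure : IsFiniteMeasure G.edgeMeasure := ⟨by
  rw [← Set.univ_prod_univ, G.edgeMeasure_prod MeasurableSet.univ MeasurableSet.univ]
  exact ENNReal.ofReal_lt_top⟩

/-- The edge measure is concentrated on the edges. -/
theorem ae_mem_E : ∀ᵐ p ∂G.edgeMeasure, p ∈ G.E := by
  have h : G.edgeMeasure G.Eᶜ = 0 := by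
    rw [edgeMeasure, Measure.bind_apply G.measurableSet_E.compl G.measurable_edgeFiber.aemeasurable]
    simp [G.edgeFiber_apply _ G.measurableSet_E.compl]
  exact h

/-- Both marginals of the edge measure are bounded by a multiple of the vertex measure. -/
theorem exists_edgeMeasure_marginal_le : ∃ D : ℕ,
    G.edgeMeasure.map Prod.fst ≤ (D : ℝ≥0∞) • G.μ ∧
      G.edgeMeasure.map Prod.snd ≤ (D : ℝ≥0∞) • G.μ := by
  obtain ⟨D, -, hD⟩ := G.bounded_degree
  have hdeg : ∀ x, degIn G.E univ x ≤ D := fun x => by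
    have hle : (nbrsIn G.E univ x).encard ≤ (D : ℕ∞) :=
      (Set.encard_le_encard (fun y hy => hy.2)).trans (hD x)
    have hfin : (nbrsIn G.E univ x).Finite := Set.finite_of_encard_le_coe hle
    rw [← hfin.cast_ncard_eq] at hle
    rw [degIn]
    exact_mod_cast hle
  have hle : ∀ A : Set I, MeasurableSet A →
      ENNReal.ofReal (G.e A univ) ≤ (D : ℝ≥0∞) * G.μ A := fun A hA => by
    have h1 : G.e A univ ≤ ∫ _ in A, (D : ℝ) ∂G.μ :=
      integral_mono (G.integrable_degIn MeasurableSet.univ).integrableOn (integrable_const _) hdeg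
    refine (ENNReal.ofReal_le_ofReal h1).trans ?_
    rw [setIntegral_const, smul_eq_mul, mul_comm, ENNReal.ofReal_mul (Nat.cast_nonneg _),
      ENNReal.ofReal_natCast, ofReal_measureReal]
  refine ⟨D, Measure.le_iff.2 fun A hA => ?_, Measure.le_iff.2 fun A hA => ?_⟩
  · rw [Measure.map_apply measurable_fst hA, ← Set.prod_univ,
      G.edgeMeasure_prod hA MeasurableSet.univ]
    exact hle A hA
  · rw [Measure.map_apply measurable_snd hA, ← Set.univ_prod,
      -- Balance reduces the second marginal to the first.
      G.edgeMeasure_prod MeasurableSet.univ hA, e, G.balanced _ _ MeasurableSet.univ hA]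
    exact hle A hA

theorem quasiMeasurePreserving_fst :
    Measure.QuasiMeasurePreserving Prod.fst G.edgeMeasure G.μ :=
  have ⟨_, h, _⟩ := G.exists_edgeMeasure_marginal_le
  ⟨measurable_fst, h.absolutelyContinuous.trans (Measure.smul_absolutelyContinuous)⟩

theorem quasiMeasurePreserving_snd :
    Measure.QuasiMeasurePreserving Prod.snd G.edgeMeasure G.μ :=
  have ⟨_, _, h⟩ := G.exists_edgeMeasure_marginal_le
  ⟨measurable_snd, h.absolutelyContinuous.trans (Measure.smul_absolutelyContinuous)⟩

theorem integrable_comp_fst {h : I → ℝ} (hh : Integrable h G.μ) :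
    Integrable (fun p : I × I => h p.1) G.edgeMeasure := by
  obtain ⟨D, hD, -⟩ := G.exists_edgeMeasure_marginal_le
  exact ((hh.smul_measure (ENNReal.natCast_ne_top D)).mono_measure hD).comp_measurable
    measurable_fst

theorem integrable_comp_snd {h : I → ℝ} (hh : Integrable h G.μ) :
    Integrable (fun p : I × I => h p.2) G.edgeMeasure := by
  obtain ⟨D, -, hD⟩ := G.exists_edgeMeasure_marginal_le
  exact ((hh.smul_measure (ENNReal.natCast_ne_top D)).mono_measure hD).comp_measurable
    measurable_snd

/-- Almost no vertex has a neighbour in a given null set. -/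
theorem ae_forall_nbr {P : I → Prop} (hP : ∀ᵐ y ∂G.μ, P y) :
    ∀ᵐ x ∂G.μ, ∀ y, (x, y) ∈ G.E → P y := by
  -- Balance is available only for Borel sets, so the exceptional set is enlarged to a Borel null
  -- set.
  set N := toMeasurable G.μ {y | ¬ P y} with hN
  have hNm : MeasurableSet N := measurableSet_toMeasurable _ _
  have hN0 : G.μ N = 0 := by rw [hN, measure_toMeasurable]; exact hP
  have h0 : ∫ x, degIn G.E N x ∂G.μ = 0 := by
    rw [← setIntegral_univ, G.balanced _ _ MeasurableSet.univ hNm, Measure.restrict_eq_zero.2 hN0,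
      integral_zero_measure]
  rw [integral_eq_zero_iff_of_nonneg (f := degIn G.E N) (fun x => Nat.cast_nonneg _)
    (G.integrable_degIn hNm)] at h0
  filter_upwards [h0] with x hx y hy
  by_contra hPy
  have hyN : y ∈ nbrsIn G.E N x := ⟨subset_toMeasurable _ _ hPy, hy⟩
  -- `ncard` also vanishes on infinite sets, so finiteness must be known first.
  obtain ⟨D, -, hD⟩ := G.bounded_degree
  have hfin : (nbrsIn G.E N x).Finite := Set.finite_of_encard_le_coe
    ((Set.encard_le_encard (fun y hy => hy.2)).trans (hD x))
  have hx' : (nbrsIn G.E N x).ncard = 0 := Nat.cast_eq_zero.1 (show degIn G.E N x = 0 from hx)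
  rw [Set.ncard_eq_zero hfin] at hx'
  simp [hx'] at hyN

/-- Changing `B` on a null set alters `deg_B` only at vertices with a neighbour in that set, and
these form a null set. -/
theorem e_congr_ae {A A' B B' : Set I} (hA : A =ᵐ[G.μ] A') (hB : B =ᵐ[G.μ] B') :
    G.e A B = G.e A' B' := by
  rw [e, e, setIntegral_congr_set hA]
  refine integral_congr_ae (ae_restrict_of_ae ?_)
  filter_upwards [G.ae_forall_nbr hB.mem_iff] with x hx
  have : nbrsIn G.E B x = nbrsIn G.E B' x := by
    ext y
    simp only [nbrsIn, mem_ofPred_eq]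
    exact and_congr_left fun h => hx y h
  rw [degIn, degIn, this]

/-- The layer-cake identity behind the co-area formula, for a reparametrisation `s` of the levels
for which `w` measures the set of levels that separate two values. -/
theorem setLIntegral_abs_edgeDiff {f : I → ℝ} (hf : Measurable f) {s w : ℝ → ℝ}
    (hs : Measurable s)
    (hvol : ∀ a b, a < b →
      volume.restrict (Ioi 0) {t | a ≤ s t ∧ s t < b} = ENNReal.ofReal |w b - w a|) :
    ∫⁻ p in G.orientedEdges f, ENNReal.ofReal |edgeDiff (fun x => w (f x)) p| ∂G.edgeMeasure =
        ∫⁻ t in Ioi 0, ENNReal.ofReal (G.e (superlevel f (s t))ᶜ (superlevel f (s t))) ∧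
      Measurable fun t => G.e (superlevel f (s t))ᶜ (superlevel f (s t)) := by
  -- The two iterated measures of `T` are the two sides of the identity.
  set T : Set ((I × I) × ℝ) := {q | f q.1.1 ≤ s q.2 ∧ s q.2 < f q.1.2} with hT
  have hTm : MeasurableSet T :=
    (measurableSet_le (hf.comp (measurable_fst.comp measurable_fst)) (hs.comp measurable_snd)).inter
      (measurableSet_lt (hs.comp measurable_snd) (hf.comp (measurable_snd.comp measurable_fst)))
  have hSm : ∀ t, MeasurableSet (superlevel f t) := fun t => hf measurableSet_Ioi
  have hsec : ∀ t, G.edgeMeasure ((fun p => (p, t)) ⁻¹' T) =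
      ENNReal.ofReal (G.e (superlevel f (s t))ᶜ (superlevel f (s t))) := fun t => by
    rw [← G.edgeMeasure_prod (hSm _).compl (hSm _)]
    congr 1
    ext p
    simp [hT, superlevel]
  have hEm : MeasurableSet (G.orientedEdges f) :=
    G.measurableSet_E.inter (measurableSet_lt (hf.comp measurable_fst) (hf.comp measurable_snd))
  constructor
  · have h1 := Measure.prod_apply (μ := G.edgeMeasure) (ν := volume.restrict (Ioi (0 : ℝ))) hTm
    rw [Measure.prod_apply_symm hTm] at h1
    simp only [hsec] at h1
    rw [h1, ← lintegral_indicator hEm]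
    refine lintegral_congr_ae ?_
    -- `T` does not ask for `p ∈ G.E`, but `η`-almost every pair is an edge.
    filter_upwards [G.ae_mem_E] with p hp
    by_cases h : f p.1 < f p.2
    · rw [indicator_of_mem (show p ∈ G.orientedEdges f from ⟨hp, h⟩)]
      exact (hvol _ _ h).symm
    · rw [indicator_of_notMem (fun h' : p ∈ G.orientedEdges f => h h'.2)]
      have : Prod.mk p ⁻¹' T = ∅ := by
        ext t
        simp only [hT, mem_preimage, mem_ofPred_eq, mem_empty_iff_false, iff_false]
        exact fun h' => h (h'.1.trans_lt h'.2)
      rw [this, measure_empty]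
  · have h2 := (measurable_measure_prodMk_right (μ := G.edgeMeasure) hTm).ennreal_toReal
    simpa only [hsec, ENNReal.toReal_ofReal (G.e_nonneg _ _)] using h2

/-- The co-area formula for a reparametrisation `s` of the levels. -/
theorem coarea {f : I → ℝ} (hf : MemLp f 2 G.μ) {s w : ℝ → ℝ} (hs : Measurable s)
    (hw : Measurable w) (hw0 : ∀ a, |w a| ≤ a ^ 2)
    (hvol : ∀ a b, a < b →
      volume.restrict (Ioi 0) {t | a ≤ s t ∧ s t < b} = ENNReal.ofReal |w b - w a|) :
    IntegrableOn (fun p => |edgeDiff (fun x => w (f x)) p|) (G.orientedEdges f) G.edgeMeasure ∧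
      IntegrableOn (fun t => G.e (superlevel f (s t))ᶜ (superlevel f (s t))) (Ioi 0) ∧
      (∫ p in G.orientedEdges f, |edgeDiff (fun x => w (f x)) p| ∂G.edgeMeasure) =
        ∫ t in Ioi 0, G.e (superlevel f (s t))ᶜ (superlevel f (s t)) := by
  obtain ⟨g, hgm, hfg⟩ := hf.aestronglyMeasurable.aemeasurable
  have hlevel : ∀ t, superlevel f t =ᵐ[G.μ] superlevel g t := fun t => by
    filter_upwards [hfg] with x hx
    change (f x ∈ Ioi t) = (g x ∈ Ioi t)
    rw [hx]
  have hint : Integrable (fun x => w (f x)) G.μ :=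
    hf.integrable_sq.mono' (hw.comp_aemeasurable
      hf.aestronglyMeasurable.aemeasurable).aestronglyMeasurable (ae_of_all _ fun x => hw0 _)
  have hI : IntegrableOn (fun p => |edgeDiff (fun x => w (f x)) p|) (G.orientedEdges f)
      G.edgeMeasure :=
    ((G.integrable_comp_snd hint).sub (G.integrable_comp_fst hint)).abs.integrableOn
  obtain ⟨hcore, hmeas⟩ := G.setLIntegral_abs_edgeDiff hgm hs hvol
  have he : ∀ t, G.e (superlevel g (s t))ᶜ (superlevel g (s t)) =
      G.e (superlevel f (s t))ᶜ (superlevel f (s t)) := fun t =>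
    G.e_congr_ae (hlevel _).symm.compl (hlevel _).symm
  simp only [he] at hcore hmeas
  have h1 : ∀ᵐ p ∂G.edgeMeasure, f p.1 = g p.1 := G.quasiMeasurePreserving_fst.ae hfg
  have h2 : ∀ᵐ p ∂G.edgeMeasure, f p.2 = g p.2 := G.quasiMeasurePreserving_snd.ae hfg
  have hE : G.orientedEdges f =ᵐ[G.edgeMeasure] G.orientedEdges g := by
    filter_upwards [h1, h2] with p hp1 hp2
    change (p ∈ G.E ∧ f p.1 < f p.2) = (p ∈ G.E ∧ g p.1 < g p.2)
    rw [hp1, hp2]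
  have hcore' : ∫⁻ p in G.orientedEdges f,
      ENNReal.ofReal |edgeDiff (fun x => w (f x)) p| ∂G.edgeMeasure =
        ∫⁻ t in Ioi 0, ENNReal.ofReal (G.e (superlevel f (s t))ᶜ (superlevel f (s t))) := by
    rw [← hcore, setLIntegral_congr hE]
    refine lintegral_congr_ae (ae_restrict_of_ae ?_)
    filter_upwards [h1, h2] with p hp1 hp2
    simp only [edgeDiff, hp1, hp2]
  refine ⟨hI, ⟨hmeas.aestronglyMeasurable, ?_⟩, ?_⟩
  -- Finiteness on the level side is inherited from the edge side.
  · rw [hasFiniteIntegral_iff_ofReal (ae_of_all _ fun t => G.e_nonneg _ _), ← hcore',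
      ← hasFiniteIntegral_iff_ofReal (ae_of_all _ fun p => abs_nonneg _)]
    exact hI.2
  · rw [integral_eq_lintegral_of_nonneg_ae (ae_of_all _ fun p => abs_nonneg _) hI.1,
      integral_eq_lintegral_of_nonneg_ae (ae_of_all _ fun t => G.e_nonneg _ _)
        hmeas.aestronglyMeasurable, hcore']

end Graphing

/-! ### Lengths of the sets of separating levels, and the substitution -/

theorem volume_levels_sqrt (a b : ℝ) (hab : a < b) :
    volume.restrict (Ioi 0) {t : ℝ | a ≤ √t ∧ √t < b} =
      ENNReal.ofReal |max b 0 ^ 2 - max a 0 ^ 2| := by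
  have hle : max a 0 ^ 2 ≤ max b 0 ^ 2 :=
    pow_le_pow_left₀ (le_max_right _ _) (max_le_max_right 0 hab.le) 2
  rw [abs_of_nonneg (sub_nonneg.2 hle), ← Real.volume_Ico,
    -- The level set is `[a_+², b_+²)`, which may contain `0`; adding this null point makes the sets
    -- equal exactly.
    Measure.restrict_congr_set (Ioi_ae_eq_Ici (a := (0 : ℝ))),
    Measure.restrict_apply' measurableSet_Ici]
  congr 1
  ext t
  simp only [mem_inter_iff, mem_ofPred_eq, mem_Ici, mem_Ico]
  constructor
  · rintro ⟨⟨h1, h2⟩, ht⟩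
    have hb : √t < max b 0 := lt_max_of_lt_left h2
    exact ⟨(Real.le_sqrt (le_max_right _ _) ht).1 (max_le h1 (Real.sqrt_nonneg _)),
      (Real.sqrt_lt' ((Real.sqrt_nonneg _).trans_lt hb)).1 hb⟩
  · rintro ⟨h1, h2⟩
    have ht : 0 ≤ t := (sq_nonneg _).trans h1
    have hb : √t < max b 0 := (Real.sqrt_lt ht (le_max_right _ _)).2 h2
    exact ⟨⟨(le_max_left _ _).trans (Real.le_sqrt_of_sq_le h1),
      (lt_max_iff.1 hb).resolve_right (Real.sqrt_nonneg _).not_gt⟩, ht⟩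

/-- As `-√t` decreases in `t`, the levels form `(b_-², a_-²]`, which never contains `0`; hence `Ioi
0` needs no change. -/
theorem volume_levels_neg_sqrt (a b : ℝ) (hab : a < b) :
    volume.restrict (Ioi 0) {t : ℝ | a ≤ -√t ∧ -√t < b} =
      ENNReal.ofReal |(-min b 0) ^ 2 - (-min a 0) ^ 2| := by
  have h0 : ∀ c : ℝ, 0 ≤ -min c 0 := fun c => neg_nonneg.2 (min_le_right _ _)
  have hle : (-min b 0) ^ 2 ≤ (-min a 0) ^ 2 :=
    pow_le_pow_left₀ (h0 b) (neg_le_neg (min_le_min_right 0 hab.le)) 2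
  rw [abs_sub_comm, abs_of_nonneg (sub_nonneg.2 hle), ← Real.volume_Ioc,
    Measure.restrict_apply' measurableSet_Ioi]
  congr 1
  ext t
  simp only [mem_inter_iff, mem_ofPred_eq, mem_Ioi, mem_Ioc]
  constructor
  · rintro ⟨⟨h1, h2⟩, ht⟩
    have hs : 0 < √t := Real.sqrt_pos.2 ht
    refine ⟨(Real.lt_sqrt (h0 b)).1 (neg_lt.1 (lt_min h2 (neg_neg_of_pos hs))),
      (Real.sqrt_le_left (h0 a)).1 (le_neg.1 ((min_le_left _ _).trans h1))⟩
  · rintro ⟨h1, h2⟩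
    have ht : 0 < t := (sq_nonneg _).trans_lt h1
    have hs : 0 < √t := Real.sqrt_pos.2 ht
    have ha : min a 0 ≤ -√t := le_neg.1 ((Real.sqrt_le_left (h0 a)).2 h2)
    exact ⟨⟨(min_le_iff.1 ha).resolve_right (neg_neg_of_pos hs).not_ge,
      (neg_lt.1 ((Real.lt_sqrt (h0 b)).2 h1)).trans_le (min_le_left _ _)⟩, ht⟩

/-- The substitution `t ↦ t ^ 2` on the half-line. -/
theorem integral_comp_sqrt_Ioi {F : ℝ → ℝ} (hF : IntegrableOn (fun t => F (√t)) (Ioi 0)) :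
    IntegrableOn (fun t => 2 * t * F t) (Ioi 0) ∧
      ∫ t in Ioi 0, F (√t) = ∫ t in Ioi 0, 2 * t * F t := by
  have hcongr : ∀ t ∈ Ioi (0 : ℝ),
      (2 * t ^ ((2 : ℝ) - 1)) • F (√(t ^ (2 : ℝ))) = 2 * t * F t := fun t ht => by
    have h1 : (2 : ℝ) - 1 = 1 := by norm_num
    rw [h1, Real.rpow_one, Real.rpow_two, Real.sqrt_sq (le_of_lt ht), smul_eq_mul]
  constructor
  · have h := (integrableOn_Ioi_comp_rpow_iff (fun t => F (√t)) (two_ne_zero' ℝ)).2 hF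
    refine h.congr_fun (fun t ht => ?_) measurableSet_Ioi
    -- The integrability criterion carries the factor `|2|`, the integral formula just `2`.
    rw [← hcongr t ht, abs_of_pos (zero_lt_two' ℝ)]
  · rw [← integral_comp_rpow_Ioi_of_pos (g := fun t => F (√t)) (zero_lt_two' ℝ)]
    exact setIntegral_congr_fun measurableSet_Ioi hcongr

theorem mainTheorem6 (G : Graphing) (f : I → ℝ) (hf : MemLp f 2 G.μ) :
    (IntegrableOn (fun p => |edgeDiff (fun x => plusPart f x ^ 2) p|)
        (G.orientedEdges f) G.edgeMeasure ∧
      IntegrableOn (fun t : ℝ => G.e (superlevel f (√t))ᶜ (superlevel f (√t))) (Ioi 0) volume ∧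
      IntegrableOn (fun t : ℝ => 2 * t * G.e (superlevel f t)ᶜ (superlevel f t)) (Ioi 0) volume ∧
      (∫ p in G.orientedEdges f, |edgeDiff (fun x => plusPart f x ^ 2) p| ∂G.edgeMeasure) =
        ∫ t in Ioi (0 : ℝ), G.e (superlevel f (√t))ᶜ (superlevel f (√t)) ∧
      ∫ t in Ioi (0 : ℝ), G.e (superlevel f (√t))ᶜ (superlevel f (√t)) =
        ∫ t in Ioi (0 : ℝ), 2 * t * G.e (superlevel f t)ᶜ (superlevel f t)) ∧
    (IntegrableOn (fun p => |edgeDiff (fun x => minusPart f x ^ 2) p|)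
        (G.orientedEdges f) G.edgeMeasure ∧
      IntegrableOn (fun t : ℝ => G.e (superlevel f (-√t))ᶜ (superlevel f (-√t)))
        (Ioi 0) volume ∧
      IntegrableOn (fun t : ℝ => 2 * t * G.e (superlevel f (-t))ᶜ (superlevel f (-t)))
        (Ioi 0) volume ∧
      (∫ p in G.orientedEdges f, |edgeDiff (fun x => minusPart f x ^ 2) p| ∂G.edgeMeasure) =
        ∫ t in Ioi (0 : ℝ), G.e (superlevel f (-√t))ᶜ (superlevel f (-√t)) ∧
      ∫ t in Ioi (0 : ℝ), G.e (superlevel f (-√t))ᶜ (superlevel f (-√t)) =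
        ∫ t in Ioi (0 : ℝ), 2 * t * G.e (superlevel f (-t))ᶜ (superlevel f (-t))) := by
  obtain ⟨hp1, hp2, hp3⟩ := G.coarea hf (s := fun t => √t) (w := fun a => max a 0 ^ 2)
    (by fun_prop) (by fun_prop)
    (fun a => by
      rw [abs_of_nonneg (sq_nonneg _), sq_le_sq]
      exact abs_max_le_max_abs_abs.trans (by simp))
    volume_levels_sqrt
  obtain ⟨hm1, hm2, hm3⟩ := G.coarea hf (s := fun t => -√t) (w := fun a => (-min a 0) ^ 2)
    (by fun_prop) (by fun_prop)
    (fun a => by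
      rw [abs_of_nonneg (sq_nonneg _), sq_le_sq, abs_neg]
      exact abs_min_le_max_abs_abs.trans (by simp))
    volume_levels_neg_sqrt
  obtain ⟨hp4, hp5⟩ :=
    integral_comp_sqrt_Ioi (F := fun t => G.e (superlevel f t)ᶜ (superlevel f t)) hp2
  obtain ⟨hm4, hm5⟩ :=
    integral_comp_sqrt_Ioi (F := fun t => G.e (superlevel f (-t))ᶜ (superlevel f (-t))) hm2
  exact ⟨⟨hp1, hp2, hp4, hp3, hp5⟩, hm1, hm2, hm4, hm3, hm5⟩
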